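/- Let $T$ be a (non-degenerate, filled) triangle in the Euclidean plane. A \emph{gentiling} of $T$ is a subdivision of $T$ into finitely many, but at least two, triangles (the \emph{tiles}) with pairwise disjoint interiors and union $T$, each of which is similar to $T$ (tiles may have different sizes and may be mirror images). For $k \geq 2$, a gentiling of $T$ is \emph{$k$-splitting} if exactly $k$ of its tiles meet in one of the vertices of $T$. Let $T$ be acute. Then $T$ does not admit a $k$-splitting gentiling for any $k \geq 4$. If $T$ admits a 3-splitting gentiling, then the angles of $T$ are, in some order, either $\left(\frac{2}{13}\pi, \frac{5}{13}\pi, \frac{6}{13}\pi\right)$ or $\left(\frac{2}{15}\pi, \frac{6}{15}\pi, \frac{7}{15}\pi\right)$. -/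

import Mathlib

/-- The Euclidean plane. -/
abbrev Plane : Type := EuclideanSpace ℝ (Fin 2)

/-- The (non-degenerate) triangles in the plane. `T.points 0, T.points 1, T.points 2` are the
corners, `T.closedInterior` is the filled closed triangle, `T.interior` the open triangle. -/
abbrev PlaneTriangle : Type := Affine.Triangle ℝ Plane

namespace PlaneTriangle

/-- Two triangles are similar figures: after some matching of the corners, all distances between
corners of `S` are the corresponding distances of `T` times one positive factor
(mirror images are allowed). -/
def IsSimilar (S T : PlaneTriangle) : Prop :=
  ∃ e : Equiv.Perm (Fin 3), Similar (fun j => S.points (e j)) T.points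

/-- The angle of `T` at its corner number `i`. -/
noncomputable def angleAt (T : PlaneTriangle) (i : Fin 3) : ℝ :=
  EuclideanGeometry.angle (T.points (i + 1)) (T.points i) (T.points (i + 2))

/-- The angles of `T` are `a`, `b`, `c`, in some order. -/
def HasAngles (T : PlaneTriangle) (a b c : ℝ) : Prop :=
  ∃ e : Equiv.Perm (Fin 3), T.angleAt (e 0) = a ∧ T.angleAt (e 1) = b ∧ T.angleAt (e 2) = c

/-- The triangles `tile 0, …, tile (r - 1)` form an `r`-gentiling of `T`: there are at least two of
them, each is similar to `T`, they cover exactly `T`, and their interiors are pairwise disjoint. -/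
structure IsGentiling (T : PlaneTriangle) {r : ℕ} (tile : Fin r → PlaneTriangle) : Prop where
  two_le : 2 ≤ r
  similar : ∀ i, (tile i).IsSimilar T
  cover : ⋃ i, (tile i).closedInterior = T.closedInterior
  disjoint : Pairwise fun i j => Disjoint (tile i).interior (tile j).interior

/-- A `k`-splitting gentiling of `T`: `k ≥ 2`, and at some corner of `T` exactly `k` of the (closed)
tiles meet. -/
structure IsSplittingGentiling (T : PlaneTriangle) (k : ℕ) {r : ℕ}
    (tile : Fin r → PlaneTriangle) : Prop extends IsGentiling T tile where
  two_le_k : 2 ≤ k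
  meet : ∃ v : Fin 3, {i : Fin r | T.points v ∈ (tile i).closedInterior}.ncard = k

/-- `T` admits a `k`-splitting gentiling (with any number of tiles). -/
def AdmitsSplittingGentiling (T : PlaneTriangle) (k : ℕ) : Prop :=
  ∃ (r : ℕ) (tile : Fin r → PlaneTriangle), IsSplittingGentiling T k tile

end PlaneTriangle

open MeasureTheory Filter Topology Set

namespace PlaneTriangle

/-! Only angles are used. If a corner of an acute triangle is split into `k ≥ 3` tile angles, all of
them equal one angle `α`, and the split angle is `β = kα` (`exists_equal_split`). In units of `α`,
with `t` for a straight angle, the angles are `1`, `k`, `t - k - 1`, and acuteness means `2k < t <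
2k + 2`. If `p`, `q`, `r` tile angles of the three kinds meet at a point, then `p + kq + (t - k -
1)r` is `t` or `2t` at every tile corner that is not a corner of `T`, and is the angle of `T` at a
corner of `T`.

Every tile has one angle of each kind, so `p`, `q`, `r` have equal totals over all vertices. Weights
`x + y + z = 0` therefore give total `0`, and it is contradictory that `xp + yq + zr` be nonnegative
away from the corners of `T` and have positive sum over these corners (`weights_contradiction`).
Suitable weights exist for every `t` and `k` except `k = 3` with `2t = 13` or `2t = 15`, the two
exceptional triangles (`angle_counting`).

The angle equations come from areas: in small discs about `P`, a triangle occupies an area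
proportional to its angle at `P`, and these areas add up over the tiles (`sum_density_eq`). No
combinatorial description of the subdivision is needed. -/

/-! ### Areas of circular sectors. -/

theorem volume_sector {θ ε : ℝ} (h0 : 0 ≤ θ) (hπ : θ ≤ Real.pi) (hε : 0 ≤ ε) :
    volume.real ({z : ℂ | 0 < z.arg ∧ z.arg < θ} ∩ Metric.ball 0 ε) = θ / 2 * ε ^ 2 := by
  have hm : MeasurableSet ({z : ℂ | 0 < z.arg ∧ z.arg < θ} ∩ Metric.ball 0 ε) :=
    ((measurableSet_lt measurable_const Complex.measurable_arg).inter
      (measurableSet_lt Complex.measurable_arg measurable_const)).inter measurableSet_ball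
  set s := {z : ℂ | 0 < z.arg ∧ z.arg < θ} ∩ Metric.ball 0 ε with hs
  have h1 := Complex.integral_comp_polarCoord_symm (s.indicator (fun _ => (1 : ℝ)))
  rw [integral_indicator hm, setIntegral_const] at h1
  have h2 : ∀ p ∈ polarCoord.target,
      p.1 • s.indicator (fun _ => (1 : ℝ)) (Complex.polarCoord.symm p) =
        (Ioo 0 ε ×ˢ Ioo 0 θ).indicator (fun q : ℝ × ℝ => q.1 * 1) p := by
    intro p hp
    have hp1 : 0 < p.1 := hp.1
    have ha : (Complex.polarCoord.symm p).arg = p.2 := by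
      rw [Complex.polarCoord_symm_apply, Complex.ofReal_cos, Complex.ofReal_sin]
      exact Complex.arg_mul_cos_add_sin_mul_I hp1 ⟨hp.2.1, hp.2.2.le⟩
    have hn : ‖Complex.polarCoord.symm p‖ = p.1 := by
      rw [Complex.norm_polarCoord_symm, abs_of_pos hp1]
    have hiff : Complex.polarCoord.symm p ∈ s ↔ p ∈ Ioo 0 ε ×ˢ Ioo 0 θ := by
      simp only [hs, mem_inter_iff, mem_ofPred_eq, mem_ball_zero_iff, ha, hn, mem_prod, mem_Ioo]
      tauto
    by_cases h : p ∈ Ioo 0 ε ×ˢ Ioo 0 θ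
    · rw [indicator_of_mem h, indicator_of_mem (hiff.2 h), smul_eq_mul]
    · rw [indicator_of_notMem h, indicator_of_notMem (fun h' => h (hiff.1 h')), smul_zero]
  have hsub : Ioo 0 ε ×ˢ Ioo 0 θ ⊆ polarCoord.target := by
    rintro p ⟨h1, h2⟩
    exact ⟨h1.1, by linarith [h2.1, Real.pi_pos], by linarith [h2.2]⟩
  rw [setIntegral_congr_fun polarCoord.open_target.measurableSet h2,
    setIntegral_indicator (measurableSet_Ioo.prod measurableSet_Ioo),
    inter_eq_self_of_subset_right hsub, Measure.volume_eq_prod,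
    setIntegral_prod_mul (fun x : ℝ => x) (fun _ : ℝ => (1 : ℝ))] at h1
  rw [smul_eq_mul, mul_one] at h1
  rw [← h1, setIntegral_const, ← integral_Ioc_eq_integral_Ioo,
    ← intervalIntegral.integral_of_le hε, integral_id]
  simp [h0]
  ring

/-- The open convex cone spanned by two vectors. -/
def openCone {V : Type*} [AddCommGroup V] [Module ℝ V] (u v : V) : Set V :=
  {x | ∃ a b : ℝ, 0 < a ∧ 0 < b ∧ x = a • u + b • v}

theorem openCone_eq_sector {r : ℝ} (hr : 0 < r) {w : ℂ} (hw : 0 < w.im) :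
    openCone (r : ℂ) w = {z : ℂ | 0 < z.arg ∧ z.arg < w.arg} := by
  have hw1 : 0 < w.arg := by
    rcases (Complex.arg_nonneg_iff.2 hw.le).lt_or_eq with h | h
    · exact h
    · exact absurd (Complex.arg_eq_zero_iff.1 h.symm).2 hw.ne'
  have key : ∀ z : ℂ, 0 < z.im → (0 < w.im * z.re - w.re * z.im ↔ z.arg < w.arg) := by
    intro z hz
    have hz1 : 0 < z.arg := by
      rcases (Complex.arg_nonneg_iff.2 hz.le).lt_or_eq with h | h
      · exact h
      · exact absurd (Complex.arg_eq_zero_iff.1 h.symm).2 hz.ne'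
    have hzn : 0 < ‖z‖ := norm_pos_iff.2 (by rintro rfl; simp at hz)
    have hwn : 0 < ‖w‖ := norm_pos_iff.2 (by rintro rfl; simp at hw)
    -- The cross product of `z` and `w` has the sign of the sine of the difference of their
    -- arguments.
    have e : w.im * z.re - w.re * z.im = ‖w‖ * ‖z‖ * Real.sin (w.arg - z.arg) := by
      have : ‖w‖ * ‖z‖ * Real.sin (w.arg - z.arg) =
          (‖w‖ * Real.sin w.arg) * (‖z‖ * Real.cos z.arg) -
            (‖w‖ * Real.cos w.arg) * (‖z‖ * Real.sin z.arg) := by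
        rw [Real.sin_sub]; ring
      rw [this, Complex.norm_mul_cos_arg, Complex.norm_mul_sin_arg, Complex.norm_mul_cos_arg,
        Complex.norm_mul_sin_arg]
    rw [e]
    have := Complex.arg_le_pi w
    have := Complex.arg_le_pi z
    constructor
    · intro h
      by_contra hc
      have : Real.sin (w.arg - z.arg) ≤ 0 :=
        Real.sin_nonpos_of_nonpos_of_neg_pi_le (by linarith) (by linarith)
      have := mul_nonpos_of_nonneg_of_nonpos (mul_pos hwn hzn).le this
      linarith
    · intro h
      exact mul_pos (mul_pos hwn hzn) (Real.sin_pos_of_pos_of_lt_pi (by linarith) (by linarith))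
  ext z
  constructor
  · rintro ⟨a, b, ha, hb, rfl⟩
    have him : 0 < (a • (r : ℂ) + b • w).im := by simpa using mul_pos hb hw
    refine ⟨?_, (key _ him).1 ?_⟩
    · rcases (Complex.arg_nonneg_iff.2 him.le).lt_or_eq with h | h
      · exact h
      · exact absurd (Complex.arg_eq_zero_iff.1 h.symm).2 him.ne'
    · have := mul_pos (mul_pos ha hr) hw
      simp
      nlinarith
  · rintro ⟨h1, h2⟩
    have him : 0 < z.im := by
      rcases (Complex.arg_nonneg_iff.1 h1.le).lt_or_eq with h | h
      · exact h
      · exfalso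
        rcases le_or_gt 0 z.re with h' | h'
        · exact h1.ne' (Complex.arg_eq_zero_iff.2 ⟨h', h.symm⟩)
        · have := Complex.arg_eq_pi_iff.2 ⟨h', h.symm⟩
          linarith [Complex.arg_le_pi w]
    have hk := (key z him).2 h2
    have hc : ∀ a b : ℝ, a • (r : ℂ) + b • w = ⟨a * r + b * w.re, b * w.im⟩ := fun a b => by
      apply Complex.ext <;> simp
    refine ⟨(w.im * z.re - w.re * z.im) / (r * w.im), z.im / w.im, by positivity, by positivity, ?_⟩
    rw [hc]
    apply Complex.ext
    · field_simp
      ring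
    · field_simp

/-- A rotation takes `u` to the positive real axis; conjugation, if needed, moves `v` to the upper
half plane, so that the unoriented angle becomes an argument. -/
theorem exists_isometry_to_complex (u v : Plane) (hu : u ≠ 0) :
    ∃ φ : Plane ≃ₗᵢ[ℝ] ℂ, φ u = (‖u‖ : ℂ) ∧ 0 ≤ (φ v).im := by
  let ψ : Plane ≃ₗᵢ[ℝ] ℂ := Complex.orthonormalBasisOneI.repr.symm
  have hn : ‖ψ u‖ = ‖u‖ := ψ.norm_map u
  have hu0 : ‖u‖ ≠ 0 := norm_ne_zero_iff.2 hu
  have hψ : ψ u ≠ 0 := by rw [← norm_ne_zero_iff, hn]; exact hu0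
  obtain ⟨d, hd⟩ : ∃ d : Circle, (d : ℂ) * ψ u = ‖u‖ := by
    refine ⟨⟨(‖u‖ : ℂ) / ψ u, ?_⟩, ?_⟩
    · simp [Submonoid.unitSphere, hn, hu0]
    · simp [hψ]
  let χ := ψ.trans (rotation d)
  have hχ : χ u = ‖u‖ := by simpa [χ] using hd
  rcases le_total 0 (χ v).im with h | h
  · exact ⟨χ, hχ, h⟩
  · refine ⟨χ.trans Complex.conjLIE, ?_, ?_⟩
    · simp [hχ]
    · simpa using h

theorem volume_openCone_inter_ball {u v : Plane} (hu : u ≠ 0) (hv : ∀ c : ℝ, v ≠ c • u)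
    {ε : ℝ} (hε : 0 ≤ ε) :
    volume.real (openCone u v ∩ Metric.ball 0 ε) =
      InnerProductGeometry.angle u v / 2 * ε ^ 2 := by
  obtain ⟨φ, h1, h2⟩ := exists_isometry_to_complex u v hu
  have hu0 : 0 < ‖u‖ := norm_pos_iff.2 hu
  have him : 0 < (φ v).im := by
    rcases h2.lt_or_eq with h | h
    · exact h
    · exfalso
      apply hv ((φ v).re / ‖u‖)
      apply φ.injective
      rw [map_smul, h1]
      apply Complex.ext
      · simp [hu0.ne']
      · simp [← h]
  have hset : openCone u v ∩ Metric.ball 0 ε =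
      φ ⁻¹' (openCone ((‖u‖ : ℝ) : ℂ) (φ v) ∩ Metric.ball 0 ε) := by
    ext x
    simp only [mem_inter_iff, mem_preimage, mem_ball_zero_iff, φ.norm_map, openCone,
      mem_ofPred_eq]
    refine and_congr_left fun _ => ?_
    refine exists₂_congr fun a b => ?_
    rw [← h1, ← map_smul, ← map_smul, ← map_add, φ.injective.eq_iff]
  have hang : InnerProductGeometry.angle u v = (φ v).arg := by
    have h3 : InnerProductGeometry.angle (φ u) (φ v) = InnerProductGeometry.angle u v :=
      φ.toLinearIsometry.angle_map u v
    have hφv : φ v ≠ 0 := by intro h; rw [h] at him; simp at him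
    have h4 : ((‖u‖ : ℝ) : ℂ) = ‖u‖ • (1 : ℂ) := by simp
    rw [← h3, h1, h4, InnerProductGeometry.angle_smul_left_of_pos _ _ hu0,
      Complex.angle_one_left hφv, abs_of_nonneg (Complex.arg_nonneg_iff.2 h2)]
  rw [hset, measureReal_def,
    φ.measurePreserving.measure_preimage_emb φ.toMeasurableEquiv.measurableEmbedding,
    ← measureReal_def, openCone_eq_sector hu0 him,
    volume_sector (Complex.arg_nonneg_iff.2 him.le) (Complex.arg_le_pi _) hε, hang]

/-! ### Angular density of a set at a point. -/

/-- Near `P`, the set `U` looks like a sector of angle `θ`, as far as areas are concerned. -/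
def HasDensity (U : Set Plane) (P : Plane) (θ : ℝ) : Prop :=
  ∀ᶠ ε in 𝓝[>] (0 : ℝ), volume.real (U ∩ Metric.ball P ε) = θ / 2 * ε ^ 2

theorem HasDensity.congr {U W : Set Plane} {P : Plane} {θ : ℝ} (h : HasDensity U P θ)
    (hUW : ∀ᶠ x in 𝓝 P, (x ∈ W ↔ x ∈ U)) : HasDensity W P θ := by
  obtain ⟨δ, hδ, hb⟩ := Metric.eventually_nhds_iff.1 hUW
  filter_upwards [h, Ioo_mem_nhdsGT hδ] with ε hε hεδ
  rw [← hε]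
  congr 1
  ext x
  refine and_congr_left fun hx => hb ?_
  exact (Metric.mem_ball.1 hx).trans hεδ.2

theorem hasDensity_empty (P : Plane) : HasDensity ∅ P 0 :=
  Eventually.of_forall fun ε => by simp

theorem volume_real_ball (P : Plane) {ε : ℝ} (hε : 0 < ε) :
    volume.real (Metric.ball P ε) = Real.pi * ε ^ 2 := by
  rw [measureReal_def, InnerProductSpace.volume_ball_of_dim_even (k := 1) (by simp)]
  simp [hε.le, Real.pi_pos.le, mul_comm]

theorem hasDensity_univ (P : Plane) : HasDensity univ P (2 * Real.pi) := by
  filter_upwards [self_mem_nhdsWithin] with ε hε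
  rw [univ_inter, volume_real_ball P hε]
  ring

theorem volume_setOf_affine_eq_zero {f : Plane →ᵃ[ℝ] ℝ} (hf : ∃ x, f x ≠ 0) :
    volume {x | f x = 0} = 0 := by
  obtain ⟨x, hx⟩ := hf
  have := Measure.addHaar_affineSubspace (volume : Measure Plane)
    ((AffineSubspace.mk' (0 : ℝ) ⊥).comap f) (by
      intro h
      have : x ∈ (AffineSubspace.mk' (0 : ℝ) ⊥).comap f := by rw [h]; trivial
      rw [AffineSubspace.mem_comap, AffineSubspace.mem_mk'] at this
      exact hx (by simpa using this))
  convert! this using 2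
  ext y
  simp [AffineSubspace.mem_mk']

theorem hasDensity_halfPlane {f : Plane →ᵃ[ℝ] ℝ} (hf : ∃ x, f x ≠ 0) {P : Plane} (hP : f P = 0) :
    HasDensity {x | 0 < f x} P Real.pi := by
  have hc : Continuous f := f.continuous_of_finiteDimensional
  filter_upwards [self_mem_nhdsWithin] with ε hε
  -- The point reflection in `P` swaps the two open half planes and preserves discs about `P`, so
  -- each gets half the area; the line itself is null.
  have hrefl : ∀ x, f (P + P - x) = - f x := by
    intro x
    have h1 : P + P - x = (P -ᵥ x) +ᵥ P := by simp; abel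
    rw [h1, f.map_vadd, f.linearMap_vsub, hP]
    simp
  have hpos : MeasurableSet {x | 0 < f x} := (isOpen_lt continuous_const hc).measurableSet
  have hneg : MeasurableSet {x | f x < 0} := (isOpen_lt hc continuous_const).measurableSet
  have e1 : volume.real ({x | f x < 0} ∩ Metric.ball P ε) =
      volume.real ({x | 0 < f x} ∩ Metric.ball P ε) := by
    rw [measureReal_def, measureReal_def,
      ← (Measure.measurePreserving_sub_left (volume : Measure Plane) (P + P)).measure_preimage
        (hpos.inter measurableSet_ball).nullMeasurableSet]
    congr 2
    ext x
    have h2 : P + P - x - P = P - x := by abel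
    simp only [mem_inter_iff, mem_ofPred_eq, mem_preimage, hrefl, Metric.mem_ball, dist_eq_norm,
      h2, norm_sub_rev P x]
    constructor <;> rintro ⟨h, h'⟩ <;> exact ⟨by linarith, h'⟩
  have e2 : volume.real (({x | 0 < f x} ∩ Metric.ball P ε) ∪ ({x | f x < 0} ∩ Metric.ball P ε)) =
      volume.real (Metric.ball P ε) := by
    apply measureReal_congr
    have hz : ∀ᵐ x ∂(volume : Measure Plane), f x ≠ 0 := by
      rw [ae_iff]
      simpa using volume_setOf_affine_eq_zero hf
    filter_upwards [hz] with x hx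
    apply propext
    rcases hx.lt_or_gt with h | h
    · constructor
      · rintro (h' | h')
        · exact h'.2
        · exact h'.2
      · intro h'
        exact Or.inr ⟨h, h'⟩
    · constructor
      · rintro (h' | h')
        · exact h'.2
        · exact h'.2
      · intro h'
        exact Or.inl ⟨h, h'⟩
  rw [measureReal_union _ (hneg.inter measurableSet_ball)
    (measure_ne_top_of_subset inter_subset_right measure_ball_lt_top.ne)
    (measure_ne_top_of_subset inter_subset_right measure_ball_lt_top.ne), e1,
    volume_real_ball P hε] at e2
  · linarith
  · rw [Set.disjoint_left]
    rintro x ⟨h, -⟩ ⟨h', -⟩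
    exact lt_asymm (show 0 < f x from h) (show f x < 0 from h')

theorem hasDensity_cone {u v : Plane} (hu : u ≠ 0) (hv : ∀ c : ℝ, v ≠ c • u) (P : Plane) :
    HasDensity {x | x - P ∈ openCone u v} P (InnerProductGeometry.angle u v) := by
  filter_upwards [self_mem_nhdsWithin] with ε hε
  rw [← volume_openCone_inter_ball hu hv (le_of_lt hε), measureReal_def, measureReal_def,
    ← (measurePreserving_sub_right (volume : Measure Plane) P).measure_preimage_emb
      (MeasurableEquiv.subRight P).measurableEmbedding (openCone u v ∩ Metric.ball 0 ε)]
  congr 2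
  ext x
  simp [dist_eq_norm]

/-! ### Density of a triangle at each point, by barycentric coordinates. -/

/-- The corners of a triangle as an affine basis of the plane. -/
noncomputable def basis (S : PlaneTriangle) : AffineBasis (Fin 3) ℝ Plane :=
  ⟨S.points, S.independent,
    S.independent.affineSpan_eq_top_iff_card_eq_finrank_add_one.2 (by simp)⟩

theorem basis_apply (S : PlaneTriangle) (i : Fin 3) : S.basis i = S.points i := rfl

theorem affineCombination_coord (S : PlaneTriangle) (x : Plane) :
    Finset.univ.affineCombination ℝ S.points (fun i => S.basis.coord i x) = x :=
  S.basis.affineCombination_coord_eq_self x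

theorem mem_closedInterior_iff (S : PlaneTriangle) (x : Plane) :
    x ∈ S.closedInterior ↔ ∀ i, 0 ≤ S.basis.coord i x := by
  have hs := S.basis.sum_coord_apply_eq_one x
  conv_lhs => rw [← S.affineCombination_coord x]
  rw [Affine.Simplex.affineCombination_mem_closedInterior_iff hs]
  refine ⟨fun h i => (h i).1, fun h i => ⟨h i, ?_⟩⟩
  rw [← hs]
  exact Finset.single_le_sum (fun j _ => h j) (Finset.mem_univ i)

theorem mem_interior_iff (S : PlaneTriangle) (x : Plane) :
    x ∈ S.interior ↔ ∀ i, 0 < S.basis.coord i x := by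
  have hs := S.basis.sum_coord_apply_eq_one x
  conv_lhs => rw [← S.affineCombination_coord x]
  rw [Affine.Simplex.affineCombination_mem_interior_iff hs]
  refine ⟨fun h i => (h i).1, fun h i => ⟨h i, ?_⟩⟩
  rw [← hs]
  refine Finset.single_lt_sum (j := i + 1) (by simp) (Finset.mem_univ i) (Finset.mem_univ _)
    (h _) (fun j _ _ => (h j).le)

theorem continuous_coord (S : PlaneTriangle) (i : Fin 3) : Continuous (S.basis.coord i) :=
  (S.basis.coord i).continuous_of_finiteDimensional

theorem isOpen_interior (S : PlaneTriangle) : IsOpen S.interior := by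
  have : S.interior = ⋂ i, {x | 0 < S.basis.coord i x} := by
    ext x
    simp [mem_interior_iff]
  rw [this]
  exact isOpen_iInter_of_finite fun i => isOpen_lt continuous_const (S.continuous_coord i)

theorem volume_closedInterior_diff_interior (S : PlaneTriangle) :
    volume (S.closedInterior \ S.interior) = 0 := by
  refine measure_mono_null (t := ⋃ i, {x | S.basis.coord i x = 0}) ?_ ?_
  · rintro x ⟨h1, h2⟩
    rw [mem_closedInterior_iff] at h1
    rw [mem_interior_iff] at h2
    push Not at h2
    obtain ⟨i, hi⟩ := h2
    exact mem_iUnion.2 ⟨i, le_antisymm hi (h1 i)⟩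
  · refine measure_iUnion_null fun i => volume_setOf_affine_eq_zero ⟨S.basis i, ?_⟩
    simp

theorem sub_eq_smul_add_smul (S : PlaneTriangle) (i : Fin 3) (x : Plane) :
    x - S.points i = S.basis.coord (i + 1) x • (S.points (i + 1) - S.points i) +
      S.basis.coord (i + 2) x • (S.points (i + 2) - S.points i) := by
  have h1 := S.basis.linear_combination_coord_eq_self x
  have h2 := S.basis.sum_coord_apply_eq_one x
  simp only [Fin.sum_univ_three, basis_apply] at h1 h2
  have : x - S.points i = x - (1 : ℝ) • S.points i := by simp
  rw [this, ← h2]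
  nth_rewrite 1 [← h1]
  fin_cases i
  · simp; module
  · simp [show (1 : Fin 3) + 1 = 2 from rfl, show (1 : Fin 3) + 2 = 0 from rfl]; module
  · simp [show (2 : Fin 3) + 1 = 0 from rfl, show (2 : Fin 3) + 2 = 1 from rfl]; module

theorem coord_linear_sub (S : PlaneTriangle) (i j : Fin 3) (x : Plane) :
    (S.basis.coord j).linear (x - S.points i) = S.basis.coord j x - S.basis.coord j (S.basis i) :=
  (S.basis.coord j).linearMap_vsub x (S.points i)

theorem hasDensity_point (S : PlaneTriangle) (i : Fin 3) :
    HasDensity S.interior (S.points i) (S.angleAt i) := by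
  have hne1 : i ≠ i + 1 := by fin_cases i <;> decide
  have hne2 : i ≠ i + 2 := by fin_cases i <;> decide
  have hne3 : i + 1 ≠ i + 2 := by fin_cases i <;> decide
  have hcases : ∀ j, j = i ∨ j = i + 1 ∨ j = i + 2 := by fin_cases i <;> decide
  have lin : ∀ k, (S.basis.coord (i + 1)).linear (S.points k - S.points i) =
      (if k = i + 1 then 1 else 0) := by
    intro k
    rw [coord_linear_sub, ← basis_apply, S.basis.coord_apply, S.basis.coord_apply,
      if_neg hne1.symm, sub_zero]
    simp [eq_comm]
  have lin2 : ∀ k, (S.basis.coord (i + 2)).linear (S.points k - S.points i) =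
      (if k = i + 2 then 1 else 0) := by
    intro k
    rw [coord_linear_sub, ← basis_apply, S.basis.coord_apply, S.basis.coord_apply,
      if_neg hne2.symm, sub_zero]
    simp [eq_comm]
  refine (hasDensity_cone (u := S.points (i + 1) - S.points i)
    (v := S.points (i + 2) - S.points i) ?_ ?_ (S.points i)).congr ?_
  · exact sub_ne_zero.2 (S.independent.injective.ne hne1.symm)
  · intro c hc
    have := congrArg (S.basis.coord (i + 2)).linear hc
    rw [map_smul, lin2, lin2] at this
    simp [hne3] at this
  -- Near corner `i` its own coordinate is positive automatically, so only the two inequalities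
  -- defining the cone remain.
  · have h1 : 0 < S.basis.coord i (S.points i) := by
      rw [← basis_apply, S.basis.coord_apply_eq]; exact one_pos
    filter_upwards [(S.continuous_coord i).continuousAt.eventually_const_lt h1] with x hx
    rw [mem_interior_iff]
    constructor
    · intro h
      exact ⟨_, _, h (i + 1), h (i + 2), S.sub_eq_smul_add_smul i x⟩
    · rintro ⟨a, b, ha, hb, hab⟩ j
      rcases hcases j with rfl | rfl | rfl
      · exact hx
      · have := congrArg (S.basis.coord (i + 1)).linear hab
        rw [map_add, map_smul, map_smul, lin, lin, coord_linear_sub,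
          S.basis.coord_apply_ne hne1.symm] at this
        simp [hne3.symm] at this
        linarith
      · have := congrArg (S.basis.coord (i + 2)).linear hab
        rw [map_add, map_smul, map_smul, lin2, lin2, coord_linear_sub,
          S.basis.coord_apply_ne hne2.symm] at this
        simp [hne3] at this
        linarith

theorem eq_point_of_coord_eq_zero (S : PlaneTriangle) (i : Fin 3) {P : Plane}
    (h1 : S.basis.coord (i + 1) P = 0) (h2 : S.basis.coord (i + 2) P = 0) : P = S.points i := by
  have := S.sub_eq_smul_add_smul i P
  rw [h1, h2] at this
  simpa [sub_eq_zero] using this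

/-- A negative coordinate puts `P` outside. Otherwise at most one coordinate vanishes, since two
zeros would make `P` a corner; one zero leaves locally a half plane, none the whole plane. -/
theorem hasDensity_of_ne_point (S : PlaneTriangle) (P : Plane) (hP : ∀ i, P ≠ S.points i) :
    (P ∉ S.closedInterior ∧ HasDensity S.interior P 0) ∨
      (P ∈ S.closedInterior ∧
        (HasDensity S.interior P Real.pi ∨ HasDensity S.interior P (2 * Real.pi))) := by
  by_cases hneg : ∃ i, S.basis.coord i P < 0
  · left
    obtain ⟨i, hi⟩ := hneg
    refine ⟨fun h => ?_, (hasDensity_empty P).congr ?_⟩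
    · rw [mem_closedInterior_iff] at h
      exact absurd (h i) (not_le.2 hi)
    · filter_upwards [(S.continuous_coord i).continuousAt.eventually_lt_const hi] with x hx
      rw [mem_interior_iff]
      simp only [mem_empty_iff_false, iff_false]
      intro h
      exact lt_asymm hx (h i)
  push Not at hneg
  right
  refine ⟨(S.mem_closedInterior_iff P).2 hneg, ?_⟩
  have hcont : ∀ i, 0 < S.basis.coord i P → ∀ᶠ x in 𝓝 P, 0 < S.basis.coord i x :=
    fun i hi => (S.continuous_coord i).continuousAt.eventually_const_lt hi
  by_cases hz : ∃ i, S.basis.coord i P = 0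
  · left
    obtain ⟨i, hi⟩ := hz
    have hcases : ∀ j, j = i ∨ j = i + 1 ∨ j = i + 2 := by fin_cases i <;> decide
    have h2 : 0 < S.basis.coord (i + 2) P := by
      refine lt_of_le_of_ne (hneg _) fun h => hP (i + 1) ?_
      refine S.eq_point_of_coord_eq_zero (i + 1) ?_ ?_
      · rw [add_assoc]; exact h.symm
      · rw [add_assoc, show (1 : Fin 3) + 2 = 0 from rfl, add_zero]; exact hi
    have h1 : 0 < S.basis.coord (i + 1) P := by
      refine lt_of_le_of_ne (hneg _) fun h => hP (i + 2) ?_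
      refine S.eq_point_of_coord_eq_zero (i + 2) ?_ ?_
      · rw [add_assoc, show (2 : Fin 3) + 1 = 0 from rfl, add_zero]; exact hi
      · rw [add_assoc, show (2 : Fin 3) + 2 = 1 from rfl]; exact h.symm
    refine (hasDensity_halfPlane (f := S.basis.coord i) ⟨S.basis i, by simp⟩ hi).congr ?_
    filter_upwards [hcont _ h1, hcont _ h2] with x hx1 hx2
    rw [mem_interior_iff]
    refine ⟨fun h => h i, fun h j => ?_⟩
    rcases hcases j with rfl | rfl | rfl
    · exact h
    · exact hx1
    · exact hx2
  · right
    push Not at hz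
    refine (hasDensity_univ P).congr ?_
    have := eventually_all.2 fun i => hcont i (lt_of_le_of_ne (hneg i) (hz i).symm)
    filter_upwards [this] with x hx
    rw [mem_interior_iff]
    simpa using hx

/-! ### Additivity of densities over the tiles. -/

/-- Densities add up over a family of tiles. -/
theorem sum_density_eq {T : PlaneTriangle} {r : ℕ} {tile : Fin r → PlaneTriangle}
    (hcover : ⋃ i, (tile i).closedInterior = T.closedInterior)
    (hdisj : Pairwise fun i j => Disjoint (tile i).interior (tile j).interior)
    {P : Plane} {θ : Fin r → ℝ} {φ : ℝ} (hθ : ∀ i, HasDensity (tile i).interior P (θ i))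
    (hφ : HasDensity T.interior P φ) : ∑ i, θ i = φ := by
  have hae : T.interior =ᵐ[volume] ⋃ i, (tile i).interior := by
    have h1 : ∀ S : PlaneTriangle, ∀ᵐ x ∂(volume : Measure Plane),
        x ∈ S.closedInterior → x ∈ S.interior := by
      intro S
      rw [ae_iff]
      convert! S.volume_closedInterior_diff_interior using 2
      ext x
      simp
    filter_upwards [h1 T, ae_all_iff.2 fun i => h1 (tile i)] with x hx hxi
    apply propext
    change x ∈ T.interior ↔ x ∈ ⋃ i, (tile i).interior
    rw [mem_iUnion]
    constructor
    · intro h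
      have := T.interior_subset_closedInterior h
      rw [← hcover, mem_iUnion] at this
      obtain ⟨i, hi⟩ := this
      exact ⟨i, hxi i hi⟩
    · rintro ⟨i, hi⟩
      apply hx
      rw [← hcover]
      exact mem_iUnion.2 ⟨i, (tile i).interior_subset_closedInterior hi⟩
  obtain ⟨ε, ⟨h1, h2⟩, hε⟩ :=
    (((eventually_all.2 hθ).and hφ).and self_mem_nhdsWithin).exists
  have hε' : (0 : ℝ) < ε := hε
  have h3 : volume.real (T.interior ∩ Metric.ball P ε) =
      volume.real (⋃ i, ((tile i).interior ∩ Metric.ball P ε)) := by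
    rw [← iUnion_inter]
    exact measureReal_congr (hae.inter (ae_eq_refl _))
  rw [measureReal_iUnion_fintype
    (fun i j hij => (hdisj hij).mono inter_subset_left inter_subset_left)
    (fun i => (tile i).isOpen_interior.measurableSet.inter measurableSet_ball)
    (fun i => measure_ne_top_of_subset inter_subset_right measure_ball_lt_top.ne), h2,
    Finset.sum_congr rfl fun i _ => h1 i, ← Finset.sum_mul, ← Finset.sum_div] at h3
  have := mul_right_cancel₀ (by positivity) h3
  linarith

/-! ### Diophantine inequalities at a single vertex. -/

section Arithmetic

variable {k p q r s : ℕ} {t : ℝ}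

/-- Both `k` and `t - k - 1` are so close to `t / 2` that six of either exceed `2t`. This makes the
case analyses finite. -/
theorem multiplicities_le_five (hk : 3 ≤ k) (h1 : 2 * k < t) (h2 : t < 2 * k + 2) (hs : s ≤ 2)
    (h : p + k * q + (t - k - 1) * r = s * t) : q ≤ 5 ∧ r ≤ 5 := by
  have hk' : (3 : ℝ) ≤ k := by exact_mod_cast hk
  have hs' : (s : ℝ) ≤ 2 := by exact_mod_cast hs
  have hp : (0 : ℝ) ≤ p := p.cast_nonneg
  have hst : (s : ℝ) * t ≤ 2 * t := by nlinarith
  have hq0 : (0 : ℝ) ≤ k * q := by positivity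
  have hr0 : (0 : ℝ) ≤ (t - k - 1) * r := mul_nonneg (by linarith) r.cast_nonneg
  constructor
  · by_contra! hq
    have hq' : (6 : ℝ) ≤ q := by exact_mod_cast hq
    nlinarith
  · by_contra! hr
    have hr' : (6 : ℝ) ≤ r := by exact_mod_cast hr
    nlinarith

/-- Here the third angle is also `k`, so only `q + r` matters. The weights are `(2, -1, -1)`. -/
theorem weight_isosceles (hk : 3 ≤ k) (ht : t = 2 * k + 1) (hs : s = 1 ∨ s = 2)
    (h : p + k * q + (t - k - 1) * r = s * t) : q + r ≤ 2 * p := by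
  subst ht
  have h' : p + k * (q + r) = s * (2 * k + 1) := by
    have : (p : ℝ) + k * (q + r) = s * (2 * k + 1) := by linarith
    exact_mod_cast this
  generalize q + r = m at *
  have hm : m ≤ 4 := by
    by_contra! hm
    have : k * 5 ≤ k * m := Nat.mul_le_mul_left k hm
    rcases hs with rfl | rfl <;> omega
  rcases hs with rfl | rfl <;> interval_cases m <;> omega

/-- The weights are `(0, -1, 1)`. If `q > r`, then either the angle sum is too large or the equation
makes `t` or `2t` an integer, and the integers allowed by the bounds are excluded by hypothesis. -/
theorem weight_generic (hk : 3 ≤ k) (h1 : 2 * k < t) (h2 : t < 2 * k + 2)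
    (ht : t ≠ 2 * k + 1) (ht1 : 2 * t ≠ 4 * k + 1) (ht3 : 2 * t ≠ 4 * k + 3)
    (hs : s = 1 ∨ s = 2) (h : p + k * q + (t - k - 1) * r = s * t) : q ≤ r := by
  have hk' : (3 : ℝ) ≤ k := by exact_mod_cast hk
  have hp : (0 : ℝ) ≤ p := p.cast_nonneg
  obtain ⟨hq5, hr5⟩ := multiplicities_le_five hk h1 h2 (by omega) h
  by_contra! hlt
  have hqr : (r : ℝ) + 1 ≤ q := by exact_mod_cast hlt
  have hkq : (k : ℝ) * (r + 1) ≤ k * q := by gcongr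
  have not_eq : ∀ n : ℕ, t ≠ n := by
    rintro n rfl
    have h1' : 2 * k < n := by exact_mod_cast h1
    have h2' : n < 2 * k + 2 := by exact_mod_cast h2
    apply ht
    rw [show n = 2 * k + 1 by omega]
    push_cast
    ring
  rcases hs with rfl | rfl
  · interval_cases r
    · apply not_eq (p + k * q)
      push_cast at h ⊢
      linarith
    all_goals
      push_cast at h hkq
      linarith
  · interval_cases r
    · have h1' : (4 * k : ℝ) < p + k * q := by push_cast at h; linarith
      have h2' : (p + k * q : ℝ) < 4 * k + 4 := by push_cast at h; linarith
      have e1 : 4 * k < p + k * q := by exact_mod_cast h1'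
      have e2 : p + k * q < 4 * k + 4 := by exact_mod_cast h2'
      obtain e | e | e : p + k * q = 4 * k + 1 ∨ p + k * q = 4 * k + 2 ∨ p + k * q = 4 * k + 3 := by
        omega
      all_goals
        have e' := congrArg (Nat.cast : ℕ → ℝ) e
        push_cast at e' h
      · exact ht1 (by linarith)
      · exact ht (by linarith)
      · exact ht3 (by linarith)
    · have e : k + 1 ≤ p + k * q := by nlinarith
      apply not_eq (p + k * q - (k + 1))
      rw [Nat.cast_sub e]
      push_cast at h ⊢
      linarith
    all_goals
      push_cast at h hkq
      linarith

/-- The weights are `(4, -1, -3)`. For `k = 3` the inequality fails at `p = 0`, `q = 1`, `r = 4`, a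
full angle. -/
theorem weight_of_two_mul_eq_add_one (hk : 4 ≤ k) (ht : 2 * t = 4 * k + 1)
    (hs : s = 1 ∨ s = 2) (h : p + k * q + (t - k - 1) * r = s * t) : q + 3 * r ≤ 4 * p := by
  have hk' : (4 : ℝ) ≤ k := by exact_mod_cast hk
  obtain ⟨hq5, hr5⟩ := multiplicities_le_five (s := s) (by omega) (by linarith) (by linarith)
    (by omega) h
  have h' : 2 * p + 2 * k * q + 2 * k * r = s * (4 * k + 1) + r := by
    have : (2 * p + 2 * k * q + 2 * k * r : ℝ) = s * (4 * k + 1) + r := by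
      rw [← ht]; linear_combination 2 * h - r * ht
    exact_mod_cast this
  -- With `s`, `q`, `r` fixed, the equation is linear in `p` and `k`.
  rcases hs with rfl | rfl <;> interval_cases q <;> interval_cases r <;> omega

/-- The weights are `(4, -3, -1)`. For `k = 3` the inequality fails at `p = r = 0`, `q = 5`, a full
angle. -/
theorem weight_of_two_mul_eq_add_three (hk : 4 ≤ k) (ht : 2 * t = 4 * k + 3)
    (hs : s = 1 ∨ s = 2) (h : p + k * q + (t - k - 1) * r = s * t) : 3 * q + r ≤ 4 * p := by
  have hk' : (4 : ℝ) ≤ k := by exact_mod_cast hk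
  obtain ⟨hq5, hr5⟩ := multiplicities_le_five (s := s) (by omega) (by linarith) (by linarith)
    (by omega) h
  have h' : 2 * p + 2 * k * q + 2 * k * r + r = s * (4 * k + 3) := by
    have : (2 * p + 2 * k * q + 2 * k * r + r : ℝ) = s * (4 * k + 3) := by
      rw [← ht]; linear_combination 2 * h - r * ht
    exact_mod_cast this
  rcases hs with rfl | rfl <;> interval_cases q <;> interval_cases r <;> omega

end Arithmetic

/-! ### Global counting over all vertices. -/

/-- A weighting of the three kinds of angles with total weight zero cannot be nonnegative at all
vertices other than the corners and positive at the corners. -/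
theorem weights_contradiction {ι : Type*} [DecidableEq ι] {V : Finset ι} {A B C : ι}
    (hA : A ∈ V) (hB : B ∈ V) (hC : C ∈ V) (hAB : A ≠ B) (hAC : A ≠ C) (hBC : B ≠ C)
    {p q r : ι → ℕ} {N : ℕ} (hp : ∑ P ∈ V, p P = N) (hq : ∑ P ∈ V, q P = N)
    (hr : ∑ P ∈ V, r P = N) (x y z : ℤ) (hxyz : x + y + z = 0)
    (hother : ∀ P ∈ V, P ≠ A → P ≠ B → P ≠ C → 0 ≤ x * p P + y * q P + z * r P)
    (hcorner : 0 < (x * p A + y * q A + z * r A) + (x * p B + y * q B + z * r B) +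
      (x * p C + y * q C + z * r C)) : False := by
  have h1 : ∑ P ∈ V, (x * p P + y * q P + z * r P) = 0 := by
    rw [Finset.sum_add_distrib, Finset.sum_add_distrib, ← Finset.mul_sum, ← Finset.mul_sum,
      ← Finset.mul_sum, ← Nat.cast_sum, ← Nat.cast_sum, ← Nat.cast_sum, hp, hq, hr, ← add_mul,
      ← add_mul, hxyz, zero_mul]
  have h2 : ∑ P ∈ ({A, B, C} : Finset ι), (x * p P + y * q P + z * r P) ≤
      ∑ P ∈ V, (x * p P + y * q P + z * r P) := by
    refine Finset.sum_le_sum_of_subset_of_nonneg ?_ ?_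
    · intro P hP
      simp only [Finset.mem_insert, Finset.mem_singleton] at hP
      rcases hP with rfl | rfl | rfl <;> assumption
    · intro P hP hP'
      simp only [Finset.mem_insert, Finset.mem_singleton, not_or] at hP'
      exact hother P hP hP'.1 hP'.2.1 hP'.2.2
  rw [Finset.sum_insert (by simp [hAB, hAC]), Finset.sum_insert (by simp [hBC]),
    Finset.sum_singleton, h1] at h2
  linarith

/-- The arithmetic of the numbers of angles `1`, `k` and `t - k - 1` (where a straight angle is `t`)
at the vertices of a subdivision whose corner `B` is split into `k` angles `1`. -/
theorem angle_counting {ι : Type*} [DecidableEq ι] {V : Finset ι} {A B C : ι}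
    (hA : A ∈ V) (hB : B ∈ V) (hC : C ∈ V) (hAB : A ≠ B) (hAC : A ≠ C) (hBC : B ≠ C)
    {p q r : ι → ℕ} {N : ℕ} (hp : ∑ P ∈ V, p P = N) (hq : ∑ P ∈ V, q P = N)
    (hr : ∑ P ∈ V, r P = N) {k : ℕ} (hk : 3 ≤ k) {t : ℝ} (h1 : 2 * k < t) (h2 : t < 2 * k + 2)
    (eA : p A + k * q A + (t - k - 1) * r A = 1)
    (pB : p B = k) (qB : q B = 0) (rB : r B = 0)
    (eC : p C + k * q C + (t - k - 1) * r C = t - k - 1)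
    (hother : ∀ P ∈ V, P ≠ A → P ≠ B → P ≠ C → ∃ s : ℕ, (s = 1 ∨ s = 2) ∧
      p P + k * q P + (t - k - 1) * r P = s * t) :
    k = 3 ∧ (2 * t = 13 ∨ 2 * t = 15) := by
  have hk' : (3 : ℝ) ≤ k := by exact_mod_cast hk
  have nn : ∀ n : ℕ, n = 0 ∨ (1 : ℝ) ≤ n := fun n => by
    rcases Nat.eq_zero_or_pos n with h | h
    · exact Or.inl h
    · exact Or.inr (by exact_mod_cast h)
  -- The other two angles exceed `1`, so corner `A` is not split.
  have qA : q A = 0 := by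
    refine (nn _).resolve_right fun h => ?_
    have : (0 : ℝ) ≤ (t - k - 1) * r A := mul_nonneg (by linarith) (Nat.cast_nonneg _)
    have : (0 : ℝ) ≤ p A := Nat.cast_nonneg _
    nlinarith
  have rA : r A = 0 := by
    refine (nn _).resolve_right fun h => ?_
    have : (0 : ℝ) ≤ p A := Nat.cast_nonneg _
    rw [qA] at eA
    push_cast at eA
    nlinarith
  have pA : p A = 1 := by
    rw [qA, rA] at eA
    push_cast at eA
    have : (p A : ℝ) = 1 := by linarith
    exact_mod_cast this
  by_cases ht : t = 2 * k + 1
  · exfalso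
    refine weights_contradiction hA hB hC hAB hAC hBC hp hq hr 2 (-1) (-1) (by norm_num) ?_ ?_
    · intro P hP n1 n2 n3
      obtain ⟨s, hs, h⟩ := hother P hP n1 n2 n3
      have := weight_isosceles hk ht hs h
      omega
    · have : q C + r C ≤ 1 := by
        have e : p C + k * (q C + r C) = k := by
          have : (p C + k * (q C + r C) : ℝ) = k := by rw [ht] at eC; linarith
          exact_mod_cast this
        by_contra! h
        have : k * 2 ≤ k * (q C + r C) := Nat.mul_le_mul_left k h
        omega
      rw [pA, qA, rA, pB, qB, rB]
      omega
  have rC : r C = 1 := by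
    have e1 : (0 : ℝ) ≤ p C := Nat.cast_nonneg _
    have e2 : (0 : ℝ) ≤ k * q C := by positivity
    have e3 : r C < 2 := by
      by_contra! h
      have : (2 : ℝ) ≤ r C := by exact_mod_cast h
      nlinarith
    -- Without a third angle at `C`, the number `t - k - 1` would be an integer strictly between `k
    -- - 1` and `k + 1`, which is the isosceles case already excluded.
    have e4 : r C ≠ 0 := by
      intro h
      rw [h] at eC
      push_cast at eC
      have l1 : (k : ℝ) < p C + k * q C + 1 := by linarith
      have l2 : (p C + k * q C : ℝ) < k + 1 := by linarith
      have l1' : k < p C + k * q C + 1 := by exact_mod_cast l1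
      have l2' : p C + k * q C < k + 1 := by exact_mod_cast l2
      have l3 : p C + k * q C = k := by omega
      have l4 : (p C + k * q C : ℝ) = k := by exact_mod_cast l3
      exact ht (by linarith)
    omega
  have hpq : p C + k * q C = 0 := by
    rw [rC] at eC
    have : (p C + k * q C : ℝ) = 0 := by push_cast at eC; linarith
    exact_mod_cast this
  have pC : p C = 0 := by omega
  have qC : q C = 0 := by
    rcases Nat.mul_eq_zero.1 (show k * q C = 0 by omega) with h | h <;> omega
  by_cases ht1 : 2 * t = 4 * k + 1
  · rcases hk.eq_or_lt with rfl | hk4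
    · exact ⟨rfl, Or.inl (by push_cast at ht1; linarith)⟩
    exfalso
    refine weights_contradiction hA hB hC hAB hAC hBC hp hq hr 4 (-1) (-3) (by norm_num) ?_ ?_
    · intro P hP n1 n2 n3
      obtain ⟨s, hs, h⟩ := hother P hP n1 n2 n3
      have := weight_of_two_mul_eq_add_one hk4 ht1 hs h
      omega
    · rw [pA, qA, rA, pB, qB, rB, pC, qC, rC]
      omega
  by_cases ht3 : 2 * t = 4 * k + 3
  · rcases hk.eq_or_lt with rfl | hk4
    · exact ⟨rfl, Or.inr (by push_cast at ht3; linarith)⟩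
    exfalso
    refine weights_contradiction hA hB hC hAB hAC hBC hp hq hr 4 (-3) (-1) (by norm_num) ?_ ?_
    · intro P hP n1 n2 n3
      obtain ⟨s, hs, h⟩ := hother P hP n1 n2 n3
      have := weight_of_two_mul_eq_add_three hk4 ht3 hs h
      omega
    · rw [pA, qA, rA, pB, qB, rB, pC, qC, rC]
      omega
  exfalso
  refine weights_contradiction hA hB hC hAB hAC hBC hp hq hr 0 (-1) 1 (by norm_num) ?_ ?_
  · intro P hP n1 n2 n3
    obtain ⟨s, hs, h⟩ := hother P hP n1 n2 n3
    have := weight_generic hk h1 h2 ht ht1 ht3 hs h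
    omega
  · rw [pA, qA, rA, pB, qB, rB, pC, qC, rC]
    omega

/-! ### From tiles to numbers of angles. -/

theorem sum_angleAt (T : PlaneTriangle) : T.angleAt 0 + T.angleAt 1 + T.angleAt 2 = Real.pi := by
  have h := EuclideanGeometry.angle_add_angle_add_angle_eq_pi (p₁ := T.points 0)
    (p₂ := T.points 1) (T.points 2) (T.independent.injective.ne (by decide))
  simp only [angleAt]
  simp only [show (1 : Fin 3) + 1 = 2 from rfl, show (1 : Fin 3) + 2 = 0 from rfl,
    show (2 : Fin 3) + 1 = 0 from rfl, show (2 : Fin 3) + 2 = 1 from rfl, zero_add]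
  rw [EuclideanGeometry.angle_comm, EuclideanGeometry.angle_comm (T.points 1),
    EuclideanGeometry.angle_comm _ (T.points 0)] at h
  linarith

theorem angleAt_lt_pi_div_two {T : PlaneTriangle} (hT : T.AcuteAngled) (i : Fin 3) :
    T.angleAt i < Real.pi / 2 :=
  hT (i + 1) i (i + 2) (by fin_cases i <;> decide) (by fin_cases i <;> decide)
    (by fin_cases i <;> decide)

/-- Relabelling lets corner `j` of every tile carry angle `j` of `T`. Angles are then counted by
label rather than by size, which stays unambiguous when `T` is isosceles. -/
theorem IsSimilar.exists_relabelling {S T : PlaneTriangle} (h : S.IsSimilar T) :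
    ∃ S' : PlaneTriangle, S'.closedInterior = S.closedInterior ∧ S'.interior = S.interior ∧
      ∀ j, S'.angleAt j = T.angleAt j := by
  obtain ⟨e, he⟩ := h
  refine ⟨S.reindex e.symm, by simp, by simp, fun j => ?_⟩
  have hsim : Similar ![S.points (e (j + 1)), S.points (e j), S.points (e (j + 2))]
      ![T.points (j + 1), T.points j, T.points (j + 2)] := by
    convert! he.index_map ![j + 1, j, j + 2] using 1
    · ext i : 1
      fin_cases i <;> rfl
    · ext i : 1
      fin_cases i <;> rfl
  exact hsim.angle_eq

/-- The number of tiles whose corner number `j` is `P`. -/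
noncomputable def cornerCount {r : ℕ} (tile : Fin r → PlaneTriangle) (P : Plane) (j : Fin 3) : ℕ :=
  {i | (tile i).points j = P}.ncard

theorem cornerCount_eq_sum {r : ℕ} (tile : Fin r → PlaneTriangle) (P : Plane) (j : Fin 3)
    [∀ i, Decidable ((tile i).points j = P)] :
    cornerCount tile P j = ∑ i, if (tile i).points j = P then 1 else 0 := by
  rw [Finset.sum_boole, cornerCount, ncard_eq_toFinset_card']
  simp

open scoped Classical in
-- `m` is the number of straight angles: `1` if `P` is inside an edge, `2` if it is in the interior.
-- If `m = 0`, then `S` contains `P` only as a corner.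
theorem exists_density (S : PlaneTriangle) (P : Plane) : ∃ m : ℕ,
    HasDensity S.interior P
      (∑ j, (if S.points j = P then 1 else 0) * S.angleAt j + m * Real.pi) ∧
    (m = 0 → (∑ j, if S.points j = P then 1 else 0) = if P ∈ S.closedInterior then 1 else 0) := by
  by_cases hP : ∃ j, S.points j = P
  · obtain ⟨j, rfl⟩ := hP
    refine ⟨0, ?_, fun _ => ?_⟩
    · simpa [S.independent.injective.eq_iff] using S.hasDensity_point j
    · simp [S.independent.injective.eq_iff, S.point_mem_closedInterior j]
  · push Not at hP
    rcases S.hasDensity_of_ne_point P (fun i h => hP i h.symm) with ⟨h1, h2⟩ | ⟨h1, h2 | h2⟩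
    · exact ⟨0, by simpa [hP] using h2, fun _ => by simp [hP, h1]⟩
    · exact ⟨1, by simpa [hP] using h2, fun h => by simp at h⟩
    · exact ⟨2, by simpa [hP] using h2, fun h => by simp at h⟩

/-- The angles meeting at a point `P` of a subdivided triangle, up to straight angles. -/
theorem angle_equation {T : PlaneTriangle} {r : ℕ} {tile : Fin r → PlaneTriangle}
    (hcover : ⋃ i, (tile i).closedInterior = T.closedInterior)
    (hdisj : Pairwise fun i j => Disjoint (tile i).interior (tile j).interior)
    {α : Fin 3 → ℝ} (hangle : ∀ i j, (tile i).angleAt j = α j)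
    {P : Plane} {φ : ℝ} (hφ : HasDensity T.interior P φ) :
    ∃ m : ℕ, ∑ j, cornerCount tile P j * α j + m * Real.pi = φ ∧
      (m = 0 → {i | P ∈ (tile i).closedInterior}.ncard = ∑ j, cornerCount tile P j) := by
  classical
  choose m hm hm0 using fun i => (tile i).exists_density P
  refine ⟨∑ i, m i, ?_, fun h => ?_⟩
  · rw [← sum_density_eq hcover hdisj hm hφ, Finset.sum_add_distrib, Nat.cast_sum,
      Finset.sum_mul, Finset.sum_comm]
    congr 1
    refine Finset.sum_congr rfl fun j _ => ?_
    rw [cornerCount_eq_sum, Nat.cast_sum, Finset.sum_mul]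
    refine Finset.sum_congr rfl fun i _ => ?_
    rw [hangle]
    simp
  · have h0 : ∀ i, m i = 0 := fun i => Finset.sum_eq_zero_iff.1 h i (Finset.mem_univ i)
    simp_rw [cornerCount_eq_sum]
    rw [Finset.sum_comm, Finset.sum_congr rfl fun i _ => hm0 i (h0 i), Finset.sum_boole,
      ncard_eq_toFinset_card']
    simp

theorem sum_cornerCount {r : ℕ} (tile : Fin r → PlaneTriangle) {V : Finset Plane}
    (hV : ∀ i j, (tile i).points j ∈ V) (j : Fin 3) : ∑ P ∈ V, cornerCount tile P j = r := by
  classical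
  simp_rw [cornerCount_eq_sum]
  rw [Finset.sum_comm]
  simp [hV]

/-- If a corner of an acute triangle is split into `k ≥ 3` of its angles, these are all equal. -/
theorem exists_equal_split {α : Fin 3 → ℝ} (hα : ∀ i, α i < Real.pi / 2)
    (hsum : α 0 + α 1 + α 2 = Real.pi) {k : ℕ} (hk : 3 ≤ k) (v : Fin 3) {c : Fin 3 → ℕ}
    (hc : ∑ j, c j = k) (hv : ∑ j, c j * α j = α v) :
    ∃ e : Equiv.Perm (Fin 3), e 1 = v ∧ c (e 0) = k ∧ c (e 1) = 0 ∧ c (e 2) = 0 := by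
  have key : ∀ (x y z : ℝ) (a b d : ℕ), x < Real.pi / 2 → y < Real.pi / 2 → z < Real.pi / 2 →
      x + y + z = Real.pi → a + b + d = k → a * x + b * y + d * z = y →
      (a = k ∧ b = 0 ∧ d = 0) ∨ (d = k ∧ b = 0 ∧ a = 0) := by
    intro x y z a b d hx hy hz hs hab he
    have hx0 : 0 < x := by linarith
    have hy0 : 0 < y := by linarith
    have hz0 : 0 < z := by linarith
    have hax : 0 ≤ a * x := by positivity
    have hdz : 0 ≤ d * z := by positivity
    have hby : 0 ≤ b * y := by positivity
    -- One copy of `y` already fills the corner, leaving no room for the other `k - 1` angles.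
    have hb : b = 0 := by
      by_contra hb
      have hb1 : (1 : ℝ) ≤ b := by exact_mod_cast Nat.one_le_iff_ne_zero.2 hb
      have h1 : y ≤ b * y := le_mul_of_one_le_left hy0.le hb1
      have ha : a = 0 := by
        by_contra ha
        have : 0 < a * x := mul_pos (by exact_mod_cast Nat.pos_of_ne_zero ha) hx0
        linarith
      have hd : d = 0 := by
        by_contra hd
        have : 0 < d * z := mul_pos (by exact_mod_cast Nat.pos_of_ne_zero hd) hz0
        linarith
      have : (2 : ℝ) ≤ b := by exact_mod_cast (by omega : 2 ≤ b)
      nlinarith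
    by_cases ha : a = 0
    · right; omega
    by_cases hd : d = 0
    · left; omega
    -- Using both other angles would give `x + z ≤ y`, whereas `x + z = π - y > y`.
    exfalso
    have h1 : x ≤ a * x := le_mul_of_one_le_left hx0.le
      (by exact_mod_cast Nat.one_le_iff_ne_zero.2 ha)
    have h2 : z ≤ d * z := le_mul_of_one_le_left hz0.le
      (by exact_mod_cast Nat.one_le_iff_ne_zero.2 hd)
    linarith
  rw [Fin.sum_univ_three] at hc hv
  fin_cases v
  · rcases key (α 1) (α 0) (α 2) (c 1) (c 0) (c 2) (hα _) (hα _) (hα _) (by linarith) (by omega)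
      (by simp at hv; linarith) with h | h
    · exact ⟨Equiv.swap 0 1, by decide, h⟩
    · exact ⟨(Equiv.swap 0 1) * (Equiv.swap 0 2), by decide, h⟩
  · rcases key (α 0) (α 1) (α 2) (c 0) (c 1) (c 2) (hα _) (hα _) (hα _) (by linarith) (by omega)
      (by simp at hv; linarith) with h | h
    · exact ⟨1, by decide, h⟩
    · exact ⟨Equiv.swap 0 2, by decide, h⟩
  · rcases key (α 0) (α 2) (α 1) (c 0) (c 2) (c 1) (hα _) (hα _) (hα _) (by linarith) (by omega)
      (by simp at hv; linarith) with h | h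
    · exact ⟨Equiv.swap 1 2, by decide, h⟩
    · exact ⟨(Equiv.swap 1 2) * (Equiv.swap 0 2), by decide, h⟩

/-! ### Assembling geometry and arithmetic. -/

theorem splitting_number_and_angles {T : PlaneTriangle} (hT : T.AcuteAngled) {k : ℕ} (hk : 3 ≤ k)
    (h : T.AdmitsSplittingGentiling k) :
    k = 3 ∧ (T.HasAngles (2 * Real.pi / 13) (5 * Real.pi / 13) (6 * Real.pi / 13) ∨
      T.HasAngles (2 * Real.pi / 15) (6 * Real.pi / 15) (7 * Real.pi / 15)) := by
  classical
  obtain ⟨r, tile, ⟨⟨-, hsim, hcover, hdisj⟩, -, v, hmeet⟩⟩ := h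
  choose S hS1 hS2 hS3 using fun i => (hsim i).exists_relabelling
  simp_rw [← hS1] at hcover hmeet
  simp_rw [← hS2] at hdisj
  clear hsim hS1 hS2 tile
  set α := T.angleAt
  have hlt : ∀ i, α i < Real.pi / 2 := angleAt_lt_pi_div_two hT
  have hsum : α 0 + α 1 + α 2 = Real.pi := T.sum_angleAt
  have hpos : ∀ i, 0 < α i := by
    have h0 := hlt 0
    have h1 := hlt 1
    have h2 := hlt 2
    intro i
    fin_cases i <;> simp <;> linarith
  have hpi := Real.pi_pos
  have hnn : ∀ P, 0 ≤ ∑ j, cornerCount S P j * α j := fun P =>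
    Finset.sum_nonneg fun j _ => mul_nonneg (Nat.cast_nonneg _) (hpos j).le
  have hcorner : ∀ i, ∑ j, cornerCount S (T.points i) j * α j = α i ∧
      {l | T.points i ∈ (S l).closedInterior}.ncard = ∑ j, cornerCount S (T.points i) j := by
    intro i
    obtain ⟨m, h1, h2⟩ := angle_equation hcover hdisj hS3 (T.hasDensity_point i)
    -- An acute corner has no room for a straight angle, so all tiles meeting there have a corner
    -- there.
    have hm : m = 0 := by
      by_contra hm
      have : (1 : ℝ) ≤ m := by exact_mod_cast Nat.one_le_iff_ne_zero.2 hm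
      have := hnn (T.points i)
      have := hlt i
      nlinarith
    refine ⟨?_, h2 hm⟩
    rw [hm] at h1
    simpa using h1
  let V : Finset Plane := Finset.univ.image fun x : Fin r × Fin 3 => (S x.1).points x.2
  have hV : ∀ i j, (S i).points j ∈ V := fun i j =>
    Finset.mem_image.2 ⟨(i, j), Finset.mem_univ _, rfl⟩
  have hTV : ∀ i, T.points i ∈ V := by
    intro i
    by_contra hi
    have hz : ∀ j, cornerCount S (T.points i) j = 0 := by
      intro j
      rw [cornerCount, ncard_eq_zero]
      ext l
      simp only [mem_ofPred_eq, mem_empty_iff_false, iff_false]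
      intro hl
      exact hi (hl ▸ hV l j)
    have := (hcorner i).1
    simp only [hz, Nat.cast_zero, zero_mul, Finset.sum_const_zero] at this
    exact (hpos i).ne this
  have hother : ∀ P ∈ V, (∀ i, P ≠ T.points i) →
      ∃ s : ℕ, (s = 1 ∨ s = 2) ∧ ∑ j, cornerCount S P j * α j = s * Real.pi := by
    intro P hP hPT
    obtain ⟨⟨l, j⟩, -, hlj⟩ := Finset.mem_image.1 hP
    have hmem : P ∈ T.closedInterior := by
      rw [← hcover, mem_iUnion]
      exact ⟨l, hlj ▸ (S l).point_mem_closedInterior j⟩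
    have hcnt : 0 < cornerCount S P j := by
      rw [cornerCount, ncard_pos]
      exact ⟨l, hlj⟩
    have hP0 : 0 < ∑ j, cornerCount S P j * α j :=
      Finset.sum_pos' (fun j _ => mul_nonneg (Nat.cast_nonneg _) (hpos j).le)
        ⟨j, Finset.mem_univ _, mul_pos (by exact_mod_cast hcnt) (hpos j)⟩
    obtain ⟨n, hn, hd⟩ : ∃ n : ℕ, n ≤ 2 ∧ HasDensity T.interior P (n * Real.pi) := by
      rcases T.hasDensity_of_ne_point P hPT with ⟨h, -⟩ | ⟨-, h | h⟩
      · exact absurd hmem h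
      · exact ⟨1, by norm_num, by simpa using h⟩
      · exact ⟨2, by norm_num, by simpa using h⟩
    obtain ⟨m, h1, -⟩ := angle_equation hcover hdisj hS3 hd
    -- At least one tile has a corner at `P`, so straight angles do not use up the whole angle `nπ`.
    have hmn : m < n := by
      have : (m : ℝ) < n := by
        by_contra! hmn
        have := mul_le_mul_of_nonneg_right hmn hpi.le
        linarith
      exact_mod_cast this
    refine ⟨n - m, by omega, ?_⟩
    rw [Nat.cast_sub hmn.le]
    linarith
  obtain ⟨e, hev, e0, e1, e2⟩ := exists_equal_split hlt hsum hk v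
    ((hcorner v).2.symm.trans hmeet) (hcorner v).1
  subst hev
  have hperm : ∀ f : Fin 3 → ℝ, ∑ j, f j = f (e 0) + f (e 1) + f (e 2) := fun f => by
    rw [← Equiv.sum_comp e, Fin.sum_univ_three]
  have hsum' : α (e 0) + α (e 1) + α (e 2) = Real.pi := by
    rw [← hperm, Fin.sum_univ_three, hsum]
  have ha := hpos (e 0)
  have hv : α (e 1) = k * α (e 0) := by
    have := (hcorner (e 1)).1
    rw [hperm, e0, e1, e2] at this
    simpa using this.symm
  have hb1 := hlt (e 1)
  have hb2 := hlt (e 2)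
  -- The repeated angle `α (e 0)` becomes the unit.
  obtain ⟨t, ht⟩ : ∃ t, t * α (e 0) = Real.pi := ⟨Real.pi / α (e 0), by field_simp⟩
  have hc : α (e 2) = (t - k - 1) * α (e 0) := by linarith
  have heq : ∀ P (x : ℝ), ∑ j, cornerCount S P j * α j = x * α (e 0) →
      cornerCount S P (e 0) + k * cornerCount S P (e 1) + (t - k - 1) * cornerCount S P (e 2) =
        x := by
    intro P x hx
    rw [hperm, hv, hc] at hx
    apply mul_right_cancel₀ ha.ne'
    linarith
  have hinj : ∀ i j, i ≠ j → T.points (e i) ≠ T.points (e j) := fun i j hij =>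
    T.independent.injective.ne (e.injective.ne hij)
  obtain ⟨h3, h⟩ := angle_counting (k := k) (t := t) (hTV (e 0)) (hTV (e 1)) (hTV (e 2))
    (hinj 0 1 (by decide)) (hinj 0 2 (by decide)) (hinj 1 2 (by decide))
    (sum_cornerCount S hV (e 0)) (sum_cornerCount S hV (e 1)) (sum_cornerCount S hV (e 2)) hk
    (by
      have : 2 * k * α (e 0) < t * α (e 0) := by linarith
      exact lt_of_mul_lt_mul_right this ha.le)
    (by
      have : t * α (e 0) < (2 * k + 2) * α (e 0) := by linarith
      exact lt_of_mul_lt_mul_right this ha.le)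
    (heq _ 1 (by rw [(hcorner _).1, one_mul]))
    e0 e1 e2
    (heq _ _ (by rw [(hcorner _).1, hc]))
    (by
      intro P hP n0 n1 n2
      obtain ⟨s, hs, h⟩ := hother P hP (by
        intro i
        obtain ⟨j, rfl⟩ := e.surjective i
        fin_cases j <;> assumption)
      exact ⟨s, hs, heq P _ (by rw [h, ← ht, mul_assoc])⟩)
  refine ⟨h3, h.imp (fun h => ?_) (fun h => ?_)⟩
  · have ha' : α (e 0) = 2 * Real.pi / 13 := by linear_combination 2 / 13 * ht - α (e 0) / 13 * h
    -- Here the split angle `α (e 1)` is the largest of the three, hence the swap.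
    refine ⟨e * Equiv.swap 1 2, ?_, ?_, ?_⟩
    · rw [← ha']; rfl
    · have : α (e 2) = 5 * Real.pi / 13 := by
        rw [hv, h3, ha'] at hsum'; push_cast at hsum'; linarith
      exact this
    · have : α (e 1) = 6 * Real.pi / 13 := by
        rw [hv, h3, ha']; push_cast; ring
      exact this
  · have ha' : α (e 0) = 2 * Real.pi / 15 := by linear_combination 2 / 15 * ht - α (e 0) / 15 * h
    refine ⟨e, ha', ?_, ?_⟩
    · have : α (e 1) = 6 * Real.pi / 15 := by
        rw [hv, h3, ha']; push_cast; ring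
      exact this
    · have : α (e 2) = 7 * Real.pi / 15 := by
        rw [hv, h3, ha'] at hsum'; push_cast at hsum'; linarith
      exact this

end PlaneTriangle

theorem theorem8 (T : PlaneTriangle) (hT : T.AcuteAngled) :
    (∀ k : ℕ, 4 ≤ k → ¬ PlaneTriangle.AdmitsSplittingGentiling T k) ∧
    (PlaneTriangle.AdmitsSplittingGentiling T 3 →
      PlaneTriangle.HasAngles T (2 * Real.pi / 13) (5 * Real.pi / 13) (6 * Real.pi / 13) ∨
      PlaneTriangle.HasAngles T (2 * Real.pi / 15) (6 * Real.pi / 15) (7 * Real.pi / 15)) := by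
  refine ⟨fun k hk h => ?_, fun h =>
    (PlaneTriangle.splitting_number_and_angles hT le_rfl h).2⟩
  have := (PlaneTriangle.splitting_number_and_angles hT (by omega) h).1
  omega
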